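/- Consider a rational conformal model with finite set $P$ of primaries, vacuum $0$, symmetric unitary modular matrix $S$ with $S_{0p}>0$ for all $p$, and fusion multiplicities $N_{pq}^r=\sum_s S_{ps}S_{qs}\overline{S_{rs}}/S_{0s}\in\mathbb{Z}_{\ge 0}$ (Verlinde's formula). Let $d_p=S_{0p}/S_{00}$ be the quantum dimension of $p$, and let $\rho_p(\alpha)=S_{\alpha p}/S_{0p}$ be the value on $\alpha\in P$ of the irreducible representation of the fusion algebra corresponding to $p$. Let $\mathscr{L}$ be the set, ordered by inclusion, of all $\mathfrak{g}\subseteq P$ that contain $0$ and are closed under fusion ($p,q\in\mathfrak{g}$ and $N_{pq}^r>0$ imply $r\in\mathfrak{g}$). For $\mathfrak{g}\in\mathscr{L}$, primaries $p,q$ lie in the same $\mathfrak{g}$-class if $\rho_p(\alpha)=\rho_q(\alpha)$ for all $\alpha\in\mathfrak{g}$; the class of $0$ is denoted $\mathfrak{g}^{\perp}$. A $\mathfrak{g}$-class is central if its mass $\sum_{p\in \mathtt{C}}d_p^2$ is minimal among the $\mathfrak{g}$-classes $\mathtt{C}$. The central classes form an abelian group $Z(\mathfrak{g})$, the center of $\mathfrak{g}$,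 in which $\mathtt{z}\mathtt{w}$ is the class containing every $r$ with $N_{pq}^r>0$ for some $p\in\mathtt{z}$, $q\in\mathtt{w}$, and whose identity is $\mathfrak{g}^\perp$. The central character of $\mathtt{z}\in Z(\mathfrak{g})$ is $\varpi_{\mathtt{z}}(\alpha)=\rho_p(\alpha)/d_\alpha$ for $\alpha\in\mathfrak{g}$ and any $p\in\mathtt{z}$. For a subgroup $H\le Z(\mathfrak{g})$ the central quotient $\mathfrak{g}/H\in\mathscr{L}$ is $\{\alpha\in\mathfrak{g} : \varpi_{\mathtt{z}}(\alpha)=1 \text{ for all } \mathtt{z}\in H\}$; put $\partial\mathfrak{g}=\mathfrak{g}/Z(\mathfrak{g})$, $\partial^0\mathfrak{g}=\mathfrak{g}$ and $\partial^{k+1}\mathfrak{g}=\partial(\partial^k\mathfrak{g})$. For $\mathfrak{h}\subseteq\mathfrak{g}$ in $\mathscr{L}$, the restriction homomorphism $Z(\mathfrak{g})\to Z(\mathfrak{h})$ sends a central $\mathfrak{g}$-class to the $\mathfrak{h}$-class containing it, and $Z(\mathfrak{g}|\mathfrak{h})=\{\mathtt{z}\in Z(\mathfrak{g}) : \mathtt{z}\subseteq\mathfrak{h}^{\perp}\}$.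 Theorem. Suppose that $\mathfrak{h}$ is a central quotient of $\mathfrak{g}\in\mathscr{L}$, and that $N\ge 0$ is the largest integer with $\partial^N\mathfrak{h}\ne\partial^N\mathfrak{g}$. Then there is a long exact sequence of abelian groups $$1\to Z(\mathfrak{g}|\mathfrak{h})\to Z(\mathfrak{g})\to Z(\mathfrak{h})\to Z(\partial\mathfrak{g})\to Z(\partial\mathfrak{h})\to\cdots\to Z(\partial^N\mathfrak{g})\to Z(\partial^N\mathfrak{h})\to 1,$$ in which the first nontrivial map is the inclusion and all the maps between centers are the restriction homomorphisms along $\mathfrak{g}\supseteq\mathfrak{h}\supseteq\partial\mathfrak{g}\supseteq\partial\mathfrak{h}\supseteq\cdots\supseteq\partial^N\mathfrak{g}\supseteq\partial^N\mathfrak{h}$. -/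

import Mathlib

open scoped ComplexConjugate

noncomputable section

/-- The data of a rational conformal model with finite set of primaries `P` from which the
deconstruction lattice is built: the vacuum, the modular `S`-matrix (symmetric and unitary), and
the fusion multiplicities, which are natural numbers and are computed from `S` by Verlinde's
formula.  Positivity of the vacuum row of `S` means that all quantum dimensions are positive.
(Charge conjugation need not be listed: it is the permutation matrix `S * S`.) -/
structure ConformalModel (P : Type*) [Fintype P] [DecidableEq P] where
  /-- the vacuum -/
  vac : P
  /-- the modular `S`-matrix -/
  S : Matrix P P ℂ
  /-- `fusion p q r` is the multiplicity of `r` in the fusion product of `p` and `q` -/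
  fusion : P → P → P → ℕ
  symm : ∀ p q, S p q = S q p
  unitary : S * S.conjTranspose = 1
  vac_im : ∀ p, (S vac p).im = 0
  vac_pos : ∀ p, 0 < (S vac p).re
  verlinde : ∀ p q r,
    (fusion p q r : ℂ) = ∑ s, S p s * S q s * conj (S r s) / S vac s

namespace ConformalModel

variable {P : Type*} [Fintype P] [DecidableEq P] (M : ConformalModel P)

/-- The quantum dimension of a primary. -/
def qdim (p : P) : ℝ := (M.S M.vac p).re / (M.S M.vac M.vac).re

/-- `M.irr p α` is the value on the primary `α` of the irreducible (one-dimensional)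
representation of the fusion algebra that corresponds to the primary `p`. -/
def irr (p α : P) : ℂ := M.S α p / M.S M.vac p

/-- The deconstruction lattice: sets of primaries that contain the vacuum and are closed under
the fusion product, ordered by inclusion. -/
abbrev Lat : Type _ :=
  {g : Set P // M.vac ∈ g ∧ ∀ p ∈ g, ∀ q ∈ g, ∀ r, 0 < M.fusion p q r → r ∈ g}

/-- Two primaries are in the same `g`-class if the corresponding irreducible representations of
the fusion algebra coincide on the elements of `g`. -/
def classSetoid (g : M.Lat) : Setoid P where
  r p q := ∀ α ∈ g.1, M.irr p α = M.irr q α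
  iseqv := ⟨fun _ _ _ => rfl, fun h α hα => (h α hα).symm,
    fun h k α hα => (h α hα).trans (k α hα)⟩

/-- The collection of all `g`-classes. -/
abbrev Class (g : M.Lat) : Type _ := Quotient (M.classSetoid g)

/-- The `g`-class that contains the primary `p`. -/
def classOf (g : M.Lat) (p : P) : M.Class g := Quotient.mk (M.classSetoid g) p

/-- The primaries contained in a `g`-class. -/
def members {g : M.Lat} (C : M.Class g) : Set P := {p | M.classOf g p = C}

/-- The trivial class (dual) of `g`: the `g`-class that contains the vacuum, as a set. -/
def dual (g : M.Lat) : Set P := M.members (M.classOf g M.vac)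

open Classical in
/-- The mass of a `g`-class: the sum of the squared quantum dimensions of its members. -/
def mass {g : M.Lat} (C : M.Class g) : ℝ := ∑ p with p ∈ M.members C, M.qdim p ^ 2

/-- A `g`-class is central if its mass is minimal among all `g`-classes. -/
def IsCentral {g : M.Lat} (C : M.Class g) : Prop := ∀ D : M.Class g, M.mass C ≤ M.mass D

/-- The center of `g`: the collection of its central classes. -/
def Center (g : M.Lat) : Type _ := {C : M.Class g // M.IsCentral C}

/-! ### Elementary facts on the fusion algebra -/

theorem S_vac_ne (p : P) : M.S M.vac p ≠ 0 := by
  intro h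
  have := M.vac_pos p
  rw [h] at this
  simp at this

theorem S_vac_eq (p : P) : M.S M.vac p = ((M.S M.vac p).re : ℂ) := by
  apply Complex.ext <;> simp [M.vac_im p]

theorem qdim_pos (p : P) : 0 < M.qdim p := div_pos (M.vac_pos p) (M.vac_pos _)

theorem qdim_eq (p : P) : (M.qdim p : ℂ) = M.S M.vac p / M.S M.vac M.vac := by
  rw [M.S_vac_eq p, M.S_vac_eq M.vac]
  simp [qdim]

theorem irr_vac (α : P) : M.irr M.vac α = M.qdim α := by
  rw [qdim_eq, irr, M.symm α M.vac]

theorem irr_at_vac (p : P) : M.irr p M.vac = 1 := div_self (M.S_vac_ne p)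

theorem irr_comm (p α : P) : M.irr p α * M.qdim p = M.irr α p * M.qdim α := by
  rw [qdim_eq, qdim_eq, irr, irr, M.symm p α]
  have h1 := M.S_vac_ne p
  have h2 := M.S_vac_ne α
  have h3 := M.S_vac_ne M.vac
  field_simp

theorem unitary_row (p q : P) : ∑ s, M.S p s * conj (M.S q s) = if p = q then 1 else 0 := by
  have := congrFun (congrFun M.unitary p) q
  simpa [Matrix.mul_apply, Matrix.one_apply] using this

theorem unitary_col (p q : P) : ∑ s, conj (M.S s p) * M.S s q = if p = q then 1 else 0 := by
  have h : M.S.conjTranspose * M.S = 1 := mul_eq_one_comm.mp M.unitary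
  have := congrFun (congrFun h p) q
  simpa [Matrix.mul_apply, Matrix.one_apply] using this

theorem irr_mul (p α β : P) :
    M.irr p α * M.irr p β = ∑ γ, (M.fusion α β γ : ℂ) * M.irr p γ := by
  have h : ∑ γ, (M.fusion α β γ : ℂ) * M.irr p γ
      = ∑ s, M.S α s * M.S β s / M.S M.vac s / M.S M.vac p *
        ∑ γ, conj (M.S γ s) * M.S γ p := by
    simp_rw [M.verlinde, irr, Finset.sum_mul, Finset.mul_sum]
    rw [Finset.sum_comm]
    refine Finset.sum_congr rfl fun s _ => Finset.sum_congr rfl fun γ _ => ?_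
    ring
  rw [h]
  simp_rw [M.unitary_col]
  simp only [mul_ite, mul_one, mul_zero, Finset.sum_ite_eq', Finset.mem_univ, if_true, irr]
  have h1 := M.S_vac_ne p
  field_simp

theorem qdim_mul (α β : P) : M.qdim α * M.qdim β = ∑ γ, (M.fusion α β γ : ℝ) * M.qdim γ := by
  have h := M.irr_mul M.vac α β
  simp only [irr_vac] at h
  exact_mod_cast h

theorem norm_irr_le (p α : P) : ‖M.irr p α‖ ≤ M.qdim α := by
  have : Nonempty P := ⟨p⟩
  obtain ⟨β, hβ⟩ := Finite.exists_max fun β => ‖M.irr p β‖ / M.qdim β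
  set m := ‖M.irr p β‖ / M.qdim β with hm
  have hle : ∀ γ, ‖M.irr p γ‖ ≤ m * M.qdim γ := fun γ =>
    (div_le_iff₀ (M.qdim_pos γ)).mp (hβ γ)
  have hmpos : 0 < m := by
    have h1 : ‖M.irr p M.vac‖ / M.qdim M.vac ≤ m := hβ M.vac
    rw [irr_at_vac, norm_one] at h1
    exact lt_of_lt_of_le (div_pos one_pos (M.qdim_pos _)) h1
  have hβe : ‖M.irr p β‖ = m * M.qdim β := by
    rw [hm, div_mul_cancel₀ _ (M.qdim_pos β).ne']
  have key : ‖M.irr p α‖ * (m * M.qdim β) ≤ M.qdim α * (m * M.qdim β) := by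
    calc ‖M.irr p α‖ * (m * M.qdim β) = ‖M.irr p α * M.irr p β‖ := by rw [norm_mul, hβe]
      _ = ‖∑ γ, (M.fusion α β γ : ℂ) * M.irr p γ‖ := by rw [irr_mul]
      _ ≤ ∑ γ, ‖(M.fusion α β γ : ℂ) * M.irr p γ‖ := norm_sum_le _ _
      _ ≤ ∑ γ, (M.fusion α β γ : ℝ) * (m * M.qdim γ) := by
          refine Finset.sum_le_sum fun γ _ => ?_
          rw [norm_mul, Complex.norm_natCast]
          exact mul_le_mul_of_nonneg_left (hle γ) (Nat.cast_nonneg _)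
      _ = m * ∑ γ, (M.fusion α β γ : ℝ) * M.qdim γ := by
          rw [Finset.mul_sum]
          exact Finset.sum_congr rfl fun γ _ => by ring
      _ = M.qdim α * (m * M.qdim β) := by rw [← qdim_mul]; ring
  exact le_of_mul_le_mul_right key (mul_pos hmpos (M.qdim_pos β))

/-- The equality case of the triangle inequality: a phase on two primaries propagates
multiplicatively to every primary in their fusion product. -/
theorem irr_fusion {p α β γ : P} {a b : ℂ} (ha : ‖a‖ = 1) (hb : ‖b‖ = 1)
    (hα : M.irr p α = a * M.qdim α) (hβ : M.irr p β = b * M.qdim β)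
    (hN : 0 < M.fusion α β γ) : M.irr p γ = a * b * M.qdim γ := by
  have hab : ‖a * b‖ = 1 := by rw [norm_mul, ha, hb, one_mul]
  have hinv : conj (a * b) * (a * b) = 1 := by
    rw [← Complex.normSq_eq_conj_mul_self, Complex.normSq_eq_norm_sq, hab]; norm_num
  set x : P → ℂ := fun δ => conj (a * b) * M.irr p δ with hx
  have hxn : ∀ δ, ‖x δ‖ ≤ M.qdim δ := fun δ => by
    simp only [hx, norm_mul, RCLike.norm_conj]
    rw [ha, hb, one_mul, one_mul]
    exact M.norm_irr_le p δ
  have hsum : ∑ δ, (M.fusion α β δ : ℂ) * x δ = ((M.qdim α * M.qdim β : ℝ) : ℂ) := by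
    have : ∑ δ, (M.fusion α β δ : ℂ) * x δ = conj (a * b) * (M.irr p α * M.irr p β) := by
      rw [irr_mul, Finset.mul_sum]
      exact Finset.sum_congr rfl fun δ _ => by simp only [hx]; ring
    rw [this, hα, hβ]
    calc _ = (conj (a * b) * (a * b)) * (M.qdim α * M.qdim β) := by ring
      _ = _ := by rw [hinv]; push_cast; ring
  have hre : ∑ δ, (M.fusion α β δ : ℝ) * (M.qdim δ - (x δ).re) = 0 := by
    have h1 := congrArg Complex.re hsum
    rw [Complex.re_sum, Complex.ofReal_re, qdim_mul] at h1
    simp only [mul_sub, Finset.sum_sub_distrib]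
    rw [← h1]
    simp
  have hge : ∀ δ, 0 ≤ M.qdim δ - (x δ).re := fun δ =>
    sub_nonneg.mpr ((Complex.re_le_norm _).trans (hxn δ))
  have h0 := (Finset.sum_eq_zero_iff_of_nonneg fun δ _ =>
    mul_nonneg (Nat.cast_nonneg _) (hge δ)).mp hre γ (Finset.mem_univ _)
  have hxr : (x γ).re = M.qdim γ := by
    rcases mul_eq_zero.mp h0 with h | h
    · exact absurd (by exact_mod_cast h) hN.ne'
    · linarith
  have hxi : (x γ).im = 0 := by
    have h1 := hxn γ
    have h2 : ‖x γ‖ ^ 2 = (x γ).re * (x γ).re + (x γ).im * (x γ).im := by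
      rw [← Complex.normSq_eq_norm_sq, Complex.normSq_apply]
    have h3 : ‖x γ‖ ^ 2 ≤ M.qdim γ ^ 2 := by gcongr
    have h4 : (x γ).im * (x γ).im ≤ 0 := by rw [h2, hxr] at h3; nlinarith
    exact mul_self_eq_zero.mp (le_antisymm h4 (mul_self_nonneg _))
  have hxe : x γ = M.qdim γ := Complex.ext (by simpa using hxr) (by simpa using hxi)
  calc M.irr p γ = (conj (a * b) * (a * b)) * M.irr p γ := by rw [hinv, one_mul]
    _ = a * b * x γ := by simp only [hx]; ring
    _ = _ := by rw [hxe]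

theorem exists_fusion_pos (p q : P) : ∃ r, 0 < M.fusion p q r := by
  by_contra! h
  have h1 := M.qdim_mul p q
  have h2 : ∑ γ, (M.fusion p q γ : ℝ) * M.qdim γ = 0 :=
    Finset.sum_eq_zero fun γ _ => by simp [Nat.le_zero.mp (h γ)]
  rw [h2] at h1
  exact (mul_pos (M.qdim_pos p) (M.qdim_pos q)).ne' h1

theorem fusion_comm (p q r : P) : M.fusion p q r = M.fusion q p r := by
  have : (M.fusion p q r : ℂ) = M.fusion q p r := by
    rw [M.verlinde, M.verlinde]
    exact Finset.sum_congr rfl fun s _ => by ring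
  exact_mod_cast this

/-! ### Charge conjugation -/

theorem fusion_vac (p q : P) : (M.fusion p q M.vac : ℂ) = ∑ s, M.S p s * M.S q s := by
  rw [M.verlinde]
  refine Finset.sum_congr rfl fun s _ => ?_
  have h : conj (M.S M.vac s) = M.S M.vac s := Complex.conj_eq_iff_im.mpr (M.vac_im s)
  rw [h, mul_div_assoc, div_self (M.S_vac_ne s), mul_one]

theorem sum_fusion_vac_conj (p s : P) :
    ∑ q, (M.fusion p q M.vac : ℂ) * conj (M.S q s) = M.S p s := by
  simp_rw [M.fusion_vac, Finset.sum_mul]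
  rw [Finset.sum_comm]
  have : ∀ t, ∑ q, M.S p t * M.S q t * conj (M.S q s) = M.S p t * if s = t then 1 else 0 := by
    intro t
    rw [← M.unitary_col s t, Finset.mul_sum]
    exact Finset.sum_congr rfl fun q _ => by ring
  simp_rw [this]
  simp

theorem sum_fusion_vac_sq (p : P) : ∑ q, M.fusion p q M.vac ^ 2 = 1 := by
  have h : ∑ q, (M.fusion p q M.vac : ℂ) * (M.fusion p q M.vac : ℂ) = 1 := by
    have h1 : ∀ q, (M.fusion p q M.vac : ℂ) * (M.fusion p q M.vac : ℂ)
        = ∑ s, conj (M.S p s) * ((M.fusion p q M.vac : ℂ) * conj (M.S q s)) := by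
      intro q
      have h2 : (M.fusion p q M.vac : ℂ) = ∑ s, conj (M.S p s) * conj (M.S q s) := by
        have := congrArg conj (M.fusion_vac p q)
        simpa [map_sum] using this
      conv_lhs => rw [h2]
      rw [Finset.sum_mul, ← h2]
      exact Finset.sum_congr rfl fun s _ => by ring
    simp_rw [h1]
    rw [Finset.sum_comm]
    simp_rw [← Finset.mul_sum, M.sum_fusion_vac_conj]
    have := M.unitary_row p p
    rw [if_pos rfl] at this
    rw [← this]
    exact Finset.sum_congr rfl fun s _ => mul_comm _ _
  have h' : ((∑ q, M.fusion p q M.vac ^ 2 : ℕ) : ℂ) = (1 : ℕ) := by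
    push_cast
    rw [← h]
    exact Finset.sum_congr rfl fun q _ => by ring
  exact_mod_cast h'

/-- The charge conjugate: the unique primary whose fusion with `p` contains the vacuum. -/
theorem exists_conj (p : P) : ∃ q, ∀ r, M.fusion p r M.vac = if r = q then 1 else 0 := by
  have h := M.sum_fusion_vac_sq p
  obtain ⟨q, hq⟩ : ∃ q, 0 < M.fusion p q M.vac := by
    by_contra! hc
    rw [Finset.sum_eq_zero fun r _ => by simp [Nat.le_zero.mp (hc r)]] at h
    exact absurd h (by norm_num)
  refine ⟨q, fun r => ?_⟩
  rw [← Finset.add_sum_erase _ _ (Finset.mem_univ q)] at h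
  have h1 : M.fusion p q M.vac = 1 := by
    have : M.fusion p q M.vac ^ 2 ≤ 1 := by omega
    nlinarith
  split_ifs with hr
  · rw [hr, h1]
  · have h2 : ∑ x ∈ Finset.univ.erase q, M.fusion p x M.vac ^ 2 = 0 := by
      rw [h1] at h; omega
    have := (Finset.sum_eq_zero_iff.mp h2) r (Finset.mem_erase.mpr ⟨hr, Finset.mem_univ _⟩)
    exact pow_eq_zero_iff (two_ne_zero) |>.mp this

/-- Charge conjugation. -/
def bar (p : P) : P := Classical.choose (M.exists_conj p)

theorem fusion_bar (p r : P) : M.fusion p r M.vac = if r = M.bar p then 1 else 0 :=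
  Classical.choose_spec (M.exists_conj p) r

theorem S_bar (p s : P) : M.S (M.bar p) s = conj (M.S p s) := by
  have h := M.sum_fusion_vac_conj p s
  simp [M.fusion_bar] at h
  rw [← h, Complex.conj_conj]

theorem irr_bar_right (p α : P) : M.irr p (M.bar α) = conj (M.irr p α) := by
  rw [irr, irr, S_bar, map_div₀, Complex.conj_eq_iff_im.mpr (M.vac_im p)]

theorem qdim_bar (α : P) : M.qdim (M.bar α) = M.qdim α := by
  have h := M.irr_bar_right M.vac α
  rw [irr_vac, irr_vac, Complex.conj_ofReal] at h
  exact_mod_cast h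

theorem irr_bar_left (p α : P) : M.irr (M.bar p) α = conj (M.irr p α) := by
  rw [irr, irr, M.symm α, S_bar, M.symm M.vac, S_bar, map_div₀, M.symm α p, M.symm M.vac p]

theorem fusion_bar_left (β γ α : P) : M.fusion (M.bar β) γ α = M.fusion β α γ := by
  have : (M.fusion (M.bar β) γ α : ℂ) = conj (M.fusion β α γ : ℂ) := by
    rw [M.verlinde, M.verlinde, map_sum]
    refine Finset.sum_congr rfl fun s _ => ?_
    rw [S_bar, map_div₀, map_mul, map_mul, Complex.conj_conj,
      Complex.conj_eq_iff_im.mpr (M.vac_im s)]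
    ring
  rw [Complex.conj_natCast] at this
  exact_mod_cast this

/-- Elements of the deconstruction lattice are closed under charge conjugation. -/
theorem bar_mem (g : M.Lat) {α : P} (hα : α ∈ g.1) : M.bar α ∈ g.1 := by
  classical
  have hrow : ∀ δ, ∑ γ, (M.fusion α γ δ : ℝ) * M.qdim γ = M.qdim α * M.qdim δ := fun δ => by
    rw [← M.qdim_bar α, M.qdim_mul]
    exact Finset.sum_congr rfl fun γ _ => by rw [fusion_bar_left]
  by_contra hb
  have h1 : ∑ γ with γ ∈ g.1, ∑ δ with δ ∈ g.1, (M.fusion α γ δ : ℝ) * M.qdim γ * M.qdim δ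
      = ∑ γ with γ ∈ g.1, M.qdim α * M.qdim γ * M.qdim γ := by
    refine Finset.sum_congr rfl fun γ hγ => ?_
    have hγ' : γ ∈ g.1 := (Finset.mem_filter.mp hγ).2
    rw [M.qdim_mul, Finset.sum_mul]
    rw [Finset.sum_filter]
    refine Finset.sum_congr rfl fun δ _ => ?_
    split_ifs with hδ
    · ring
    · have : M.fusion α γ δ = 0 := by
        by_contra hne
        exact hδ (g.2.2 α hα γ hγ' δ (Nat.pos_of_ne_zero hne))
      simp [this]
  rw [Finset.sum_comm] at h1
  have h2 : ∑ δ with δ ∈ g.1, ∑ γ with γ ∈ g.1, (M.fusion α γ δ : ℝ) * M.qdim γ * M.qdim δ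
      < ∑ δ with δ ∈ g.1, M.qdim α * M.qdim δ * M.qdim δ := by
    refine Finset.sum_lt_sum (fun δ _ => ?_) ⟨M.vac, by simp [g.2.1], ?_⟩
    · rw [← hrow δ, ← Finset.sum_mul]
      refine mul_le_mul_of_nonneg_right ?_ (M.qdim_pos δ).le
      exact Finset.sum_le_sum_of_subset_of_nonneg (Finset.filter_subset _ _) fun γ _ _ =>
        mul_nonneg (Nat.cast_nonneg _) (M.qdim_pos γ).le
    · have h0 : ∑ γ with γ ∈ g.1, (M.fusion α γ M.vac : ℝ) * M.qdim γ * M.qdim M.vac = 0 := by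
        refine Finset.sum_eq_zero fun γ hγ => ?_
        have hγ' : γ ∈ g.1 := (Finset.mem_filter.mp hγ).2
        have hne : γ ≠ M.bar α := fun he => hb (he ▸ hγ')
        simp [M.fusion_bar, hne]
      rw [h0]
      exact mul_pos (mul_pos (M.qdim_pos _) (M.qdim_pos _)) (M.qdim_pos _)
  exact absurd h1 h2.ne

/-! ### Central classes -/

theorem classOf_eq_iff {g : M.Lat} {p q : P} :
    M.classOf g p = M.classOf g q ↔ ∀ α ∈ g.1, M.irr p α = M.irr q α := by
  unfold classOf
  rw [Quotient.eq]
  rfl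

theorem exists_classOf {g : M.Lat} (C : M.Class g) : ∃ p, M.classOf g p = C :=
  Quotient.exists_rep C

open Classical in
/-- The mass of a class is inversely proportional to the squared norm of its character. -/
theorem mass_mul (g : M.Lat) (p : P) :
    M.mass (M.classOf g p) * ∑ α with α ∈ g.1, ‖M.irr p α‖ ^ 2
      = ((M.S M.vac M.vac).re ^ 2)⁻¹ := by
  set f : P → ℂ := fun q => ∑ α with α ∈ g.1, conj (M.irr p α) * M.irr q α with hf
  have hmul : ∀ q, ∀ β ∈ g.1, M.irr q β * f q = M.irr p β * f q := by
    intro q β hβ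
    have hβ' := M.bar_mem g hβ
    have hL : M.irr q β * f q = ∑ α with α ∈ g.1, ∑ γ with γ ∈ g.1,
        (M.fusion β α γ : ℂ) * conj (M.irr p α) * M.irr q γ := by
      simp only [hf, Finset.mul_sum]
      refine Finset.sum_congr rfl fun α hα => ?_
      have hα' : α ∈ g.1 := (Finset.mem_filter.mp hα).2
      rw [show M.irr q β * (conj (M.irr p α) * M.irr q α)
        = conj (M.irr p α) * (M.irr q β * M.irr q α) by ring, irr_mul, Finset.mul_sum,
        Finset.sum_filter]
      refine Finset.sum_congr rfl fun γ _ => ?_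
      split_ifs with hγ
      · ring
      · have : M.fusion β α γ = 0 := by
          by_contra hne
          exact hγ (g.2.2 β hβ α hα' γ (Nat.pos_of_ne_zero hne))
        simp [this]
    have hR : M.irr p β * f q = ∑ γ with γ ∈ g.1, ∑ α with α ∈ g.1,
        (M.fusion β α γ : ℂ) * conj (M.irr p α) * M.irr q γ := by
      simp only [hf, Finset.mul_sum]
      refine Finset.sum_congr rfl fun γ hγ => ?_
      have hγ' : γ ∈ g.1 := (Finset.mem_filter.mp hγ).2
      have e : M.irr p β = conj (M.irr p (M.bar β)) := by
        rw [irr_bar_right, Complex.conj_conj]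
      rw [e, ← mul_assoc, ← map_mul, irr_mul, map_sum, Finset.sum_mul, Finset.sum_filter]
      refine Finset.sum_congr rfl fun α _ => ?_
      rw [fusion_bar_left, map_mul, Complex.conj_natCast]
      split_ifs with hα
      · rfl
      · have : M.fusion β α γ = 0 := by
          by_contra hne
          refine hα (g.2.2 _ hβ' γ hγ' α ?_)
          rw [fusion_bar_left]
          exact Nat.pos_of_ne_zero hne
        simp [this]
    rw [hL, hR, Finset.sum_comm]
  have hout : ∀ q, M.classOf g q ≠ M.classOf g p → f q = 0 := by
    intro q hq
    by_contra hne
    exact hq (M.classOf_eq_iff.mpr fun β hβ => mul_right_cancel₀ hne (hmul q β hβ))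
  have hin : ∀ q, M.classOf g q = M.classOf g p →
      f q = ((∑ α with α ∈ g.1, ‖M.irr p α‖ ^ 2 : ℝ) : ℂ) := by
    intro q hq
    simp only [hf]
    rw [Complex.ofReal_sum]
    refine Finset.sum_congr rfl fun α hα => ?_
    rw [M.classOf_eq_iff.mp hq α (Finset.mem_filter.mp hα).2,
      ← Complex.normSq_eq_conj_mul_self, Complex.normSq_eq_norm_sq]
  have htot : ∑ q, M.S M.vac q * M.S M.vac q * f q = 1 := by
    simp only [hf, Finset.mul_sum]
    rw [Finset.sum_comm]
    have : ∀ α, ∑ q, M.S M.vac q * M.S M.vac q * (conj (M.irr p α) * M.irr q α)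
        = conj (M.irr p α) * if α = M.vac then 1 else 0 := by
      intro α
      rw [← M.unitary_row α M.vac, Finset.mul_sum]
      refine Finset.sum_congr rfl fun q _ => ?_
      rw [Complex.conj_eq_iff_im.mpr (M.vac_im q)]
      have := M.S_vac_ne q
      simp only [irr]
      field_simp
    simp_rw [this]
    simp [g.2.1, irr_at_vac]
  have hsum : ((M.mass (M.classOf g p) : ℝ) : ℂ) * (M.S M.vac M.vac * M.S M.vac M.vac) *
      ((∑ α with α ∈ g.1, ‖M.irr p α‖ ^ 2 : ℝ) : ℂ) = 1 := by
    rw [← htot, mass, Complex.ofReal_sum, Finset.sum_mul, Finset.sum_mul, Finset.sum_filter]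
    refine Finset.sum_congr rfl fun q _ => ?_
    split_ifs with hq
    · rw [hin q hq]
      push_cast
      rw [qdim_eq]
      have := M.S_vac_ne M.vac
      field_simp
    · rw [hout q hq, mul_zero]
  have h0 := (M.vac_pos M.vac).ne'
  rw [M.S_vac_eq M.vac] at hsum
  have hsum' : M.mass (M.classOf g p) * ((M.S M.vac M.vac).re * (M.S M.vac M.vac).re) *
      (∑ α with α ∈ g.1, ‖M.irr p α‖ ^ 2) = 1 := by exact_mod_cast hsum
  field_simp
  linarith

/-- A class is central exactly when all its character values have maximal absolute value. -/
theorem isCentral_classOf {g : M.Lat} {p : P} :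
    M.IsCentral (M.classOf g p) ↔ ∀ α ∈ g.1, ‖M.irr p α‖ = M.qdim α := by
  classical
  have hD : 0 < ((M.S M.vac M.vac).re ^ 2)⁻¹ := inv_pos.mpr (pow_pos (M.vac_pos _) 2)
  have hpos : ∀ q, 0 < ∑ α with α ∈ g.1, ‖M.irr q α‖ ^ 2 := fun q => by
    refine Finset.sum_pos' (fun α _ => by positivity) ⟨M.vac, by simp [g.2.1], ?_⟩
    simp [irr_at_vac]
  have hmass : ∀ q, M.mass (M.classOf g q)
      = ((M.S M.vac M.vac).re ^ 2)⁻¹ / ∑ α with α ∈ g.1, ‖M.irr q α‖ ^ 2 := fun q =>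
    eq_div_of_mul_eq (hpos q).ne' (M.mass_mul g q)
  constructor
  · intro h
    have h1 := h (M.classOf g M.vac)
    rw [hmass, hmass, div_le_div_iff_of_pos_left hD (hpos _) (hpos _)] at h1
    have hle : ∀ α ∈ Finset.univ.filter (· ∈ g.1), ‖M.irr p α‖ ^ 2 ≤ ‖M.irr M.vac α‖ ^ 2 := by
      intro α _
      rw [irr_vac, Complex.norm_real, Real.norm_of_nonneg (M.qdim_pos α).le]
      have := M.norm_irr_le p α
      gcongr
    have heq := (Finset.sum_eq_sum_iff_of_le hle).mp (le_antisymm (Finset.sum_le_sum hle) h1)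
    intro α hα
    have h2 := heq α (by simp [hα])
    rw [irr_vac, Complex.norm_real, Real.norm_of_nonneg (M.qdim_pos α).le] at h2
    exact (pow_left_inj₀ (norm_nonneg _) (M.qdim_pos α).le two_ne_zero).mp h2
  · intro h D
    obtain ⟨q, rfl⟩ := M.exists_classOf D
    rw [hmass, hmass, div_le_div_iff_of_pos_left hD (hpos _) (hpos _)]
    refine Finset.sum_le_sum fun α hα => ?_
    rw [h α (Finset.mem_filter.mp hα).2]
    have := M.norm_irr_le q α
    gcongr

/-- The primaries contained in a central class. -/
def Center.members {M : ConformalModel P} {g : M.Lat} (z : M.Center g) : Set P :=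
  M.members z.1

theorem Center.exists_mem {M : ConformalModel P} {g : M.Lat} (z : M.Center g) :
    ∃ p, p ∈ z.members :=
  M.exists_classOf z.1

theorem Center.eq_of_mem {M : ConformalModel P} {g : M.Lat} {z w : M.Center g} {p : P}
    (hz : p ∈ z.members) (hw : p ∈ w.members) : z = w :=
  Subtype.ext (Eq.trans (Eq.symm hz) hw)

/-- The central character of a central class: the phase `ϖ` with `irr p α = ϖ α * qdim α` for
all `α` in `g` and all primaries `p` in the class. -/
def centralChar {g : M.Lat} (z : M.Center g) (α : g.1) : ℂ :=
  Quotient.lift (fun p => M.irr p α / M.qdim α)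
    (fun p q (h : ∀ β ∈ g.1, M.irr p β = M.irr q β) =>
      congrArg (· / (M.qdim α : ℂ)) (h α α.2)) z.1

variable {M}

theorem irr_eq_centralChar {g : M.Lat} {z : M.Center g} {p : P} (hp : p ∈ z.members)
    (α : g.1) : M.irr p α = M.centralChar z α * M.qdim α := by
  obtain ⟨C, hC⟩ := z
  change M.classOf g p = C at hp
  subst hp
  change _ = M.irr p α / M.qdim α * M.qdim α
  rw [div_mul_cancel₀]
  exact_mod_cast (M.qdim_pos α).ne'

theorem norm_centralChar {g : M.Lat} (z : M.Center g) (α : g.1) : ‖M.centralChar z α‖ = 1 := by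
  obtain ⟨p, hp⟩ := z.exists_mem
  have h1 : ‖M.irr p α‖ = M.qdim α := by
    refine M.isCentral_classOf.mp ?_ α α.2
    rw [show M.classOf g p = z.1 from hp]
    exact z.2
  rw [irr_eq_centralChar hp, norm_mul, Complex.norm_real,
    Real.norm_of_nonneg (M.qdim_pos _).le] at h1
  exact mul_right_cancel₀ (M.qdim_pos _).ne' (h1.trans (one_mul _).symm)

theorem centralChar_injective {g : M.Lat} {z w : M.Center g}
    (h : ∀ α, M.centralChar z α = M.centralChar w α) : z = w := by
  obtain ⟨p, hp⟩ := z.exists_mem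
  obtain ⟨q, hq⟩ := w.exists_mem
  refine Subtype.ext ?_
  rw [← show M.classOf g p = z.1 from hp, ← show M.classOf g q = w.1 from hq,
    M.classOf_eq_iff]
  intro α hα
  rw [irr_eq_centralChar hp ⟨α, hα⟩, irr_eq_centralChar hq ⟨α, hα⟩, h]

/-- Central characters are multiplicative with respect to the fusion of elements of `g`. -/
theorem centralChar_fusion {g : M.Lat} (z : M.Center g) {α β γ : g.1}
    (h : 0 < M.fusion α β γ) :
    M.centralChar z γ = M.centralChar z α * M.centralChar z β := by
  obtain ⟨p, hp⟩ := z.exists_mem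
  have h1 := M.irr_fusion (norm_centralChar z α) (norm_centralChar z β)
    (irr_eq_centralChar hp α) (irr_eq_centralChar hp β) h
  rw [irr_eq_centralChar hp] at h1
  refine mul_right_cancel₀ ?_ h1
  exact_mod_cast (M.qdim_pos γ).ne'

theorem irr_swap {p α : P} {a : ℂ} (h : M.irr p α = a * M.qdim α) :
    M.irr α p = a * M.qdim p := by
  have h1 := M.irr_comm p α
  rw [h] at h1
  have h2 : (M.qdim α : ℂ) ≠ 0 := by exact_mod_cast (M.qdim_pos α).ne'
  refine mul_right_cancel₀ h2 ?_
  rw [← h1]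
  ring

theorem irr_of_fusion {g : M.Lat} {z w : M.Center g} {p q r : P} (hp : p ∈ z.members)
    (hq : q ∈ w.members) (h : 0 < M.fusion p q r) (α : g.1) :
    M.irr r α = M.centralChar z α * M.centralChar w α * M.qdim α :=
  irr_swap (M.irr_fusion (norm_centralChar z α) (norm_centralChar w α)
    (irr_swap (irr_eq_centralChar hp α)) (irr_swap (irr_eq_centralChar hq α)) h)

/-- All primaries in the fusion products of members of two central classes lie in one and the
same central class. -/
theorem exists_mul {g : M.Lat} (z w : M.Center g) : ∃ c : M.Center g,
    ∀ p ∈ z.members, ∀ q ∈ w.members, ∀ r, 0 < M.fusion p q r → r ∈ c.members := by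
  obtain ⟨p₀, hp₀⟩ := z.exists_mem
  obtain ⟨q₀, hq₀⟩ := w.exists_mem
  obtain ⟨r₀, hr₀⟩ := M.exists_fusion_pos p₀ q₀
  refine ⟨⟨M.classOf g r₀, M.isCentral_classOf.mpr fun α hα => ?_⟩, fun p hp q hq r hr => ?_⟩
  · rw [irr_of_fusion hp₀ hq₀ hr₀ ⟨α, hα⟩, norm_mul, norm_mul, norm_centralChar,
      norm_centralChar, Complex.norm_real, Real.norm_of_nonneg (M.qdim_pos _).le]
    ring
  · exact M.classOf_eq_iff.mpr fun α hα => by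
      rw [irr_of_fusion hp hq hr ⟨α, hα⟩, irr_of_fusion hp₀ hq₀ hr₀ ⟨α, hα⟩]

/-- The charge conjugates of the members of a central class lie in one central class. -/
theorem exists_inv {g : M.Lat} (z : M.Center g) : ∃ c : M.Center g,
    ∀ p ∈ z.members, M.bar p ∈ c.members := by
  obtain ⟨p₀, hp₀⟩ := z.exists_mem
  refine ⟨⟨M.classOf g (M.bar p₀), M.isCentral_classOf.mpr fun α hα => ?_⟩, fun p hp => ?_⟩
  · rw [M.irr_bar_left, irr_eq_centralChar hp₀ ⟨α, hα⟩, RCLike.norm_conj, norm_mul,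
      norm_centralChar, Complex.norm_real, Real.norm_of_nonneg (M.qdim_pos _).le, one_mul]
  · exact M.classOf_eq_iff.mpr fun α hα => by
      rw [M.irr_bar_left, M.irr_bar_left, irr_eq_centralChar hp ⟨α, hα⟩,
        irr_eq_centralChar hp₀ ⟨α, hα⟩]

/-- The product of two central classes is the central class that contains all primaries
occurring in the fusion products of their members. -/
instance (g : M.Lat) : Mul (M.Center g) := ⟨fun z w => Classical.choose (exists_mul z w)⟩

/-- The identity element of the center is the trivial class. -/
instance (g : M.Lat) : One (M.Center g) :=
  ⟨⟨M.classOf g M.vac, M.isCentral_classOf.mpr fun α _ => by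
    rw [M.irr_vac, Complex.norm_real, Real.norm_of_nonneg (M.qdim_pos _).le]⟩⟩

/-- The inverse of a central class consists of the charge conjugates of its members. -/
instance (g : M.Lat) : Inv (M.Center g) := ⟨fun z => Classical.choose (exists_inv z)⟩

theorem mem_mul {g : M.Lat} {z w : M.Center g} {p q r : P} (hp : p ∈ z.members)
    (hq : q ∈ w.members) (h : 0 < M.fusion p q r) : r ∈ (z * w).members :=
  Classical.choose_spec (exists_mul z w) p hp q hq r h

theorem bar_mem_inv {g : M.Lat} {z : M.Center g} {p : P} (hp : p ∈ z.members) :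
    M.bar p ∈ (z⁻¹).members :=
  Classical.choose_spec (exists_inv z) p hp

theorem vac_mem_one (g : M.Lat) : M.vac ∈ (1 : M.Center g).members := rfl

theorem centralChar_mul {g : M.Lat} (z w : M.Center g) (α : g.1) :
    M.centralChar (z * w) α = M.centralChar z α * M.centralChar w α := by
  obtain ⟨p, hp⟩ := z.exists_mem
  obtain ⟨q, hq⟩ := w.exists_mem
  obtain ⟨r, hr⟩ := M.exists_fusion_pos p q
  have h1 := irr_of_fusion hp hq hr α
  rw [irr_eq_centralChar (mem_mul hp hq hr)] at h1
  refine mul_right_cancel₀ ?_ h1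
  exact_mod_cast (M.qdim_pos α).ne'

theorem centralChar_one {g : M.Lat} (α : g.1) : M.centralChar (1 : M.Center g) α = 1 := by
  have h1 := irr_eq_centralChar (vac_mem_one g) α
  rw [M.irr_vac] at h1
  have h2 : (M.qdim α : ℂ) ≠ 0 := by exact_mod_cast (M.qdim_pos α).ne'
  exact mul_right_cancel₀ h2 (h1.symm.trans (one_mul _).symm)

theorem centralChar_inv {g : M.Lat} (z : M.Center g) (α : g.1) :
    M.centralChar z⁻¹ α = conj (M.centralChar z α) := by
  obtain ⟨p, hp⟩ := z.exists_mem
  have h1 := irr_eq_centralChar (bar_mem_inv hp) α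
  rw [M.irr_bar_left, irr_eq_centralChar hp, map_mul, Complex.conj_ofReal] at h1
  have h2 : (M.qdim α : ℂ) ≠ 0 := by exact_mod_cast (M.qdim_pos α).ne'
  exact (mul_right_cancel₀ h2 h1).symm

instance (g : M.Lat) : CommGroup (M.Center g) where
  mul_assoc a b c := centralChar_injective fun α => by
    simp only [centralChar_mul, mul_assoc]
  one_mul a := centralChar_injective fun α => by
    simp only [centralChar_mul, centralChar_one, one_mul]
  mul_one a := centralChar_injective fun α => by
    simp only [centralChar_mul, centralChar_one, mul_one]
  mul_comm a b := centralChar_injective fun α => by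
    simp only [centralChar_mul, mul_comm]
  inv_mul_cancel a := centralChar_injective fun α => by
    rw [centralChar_mul, centralChar_one, centralChar_inv, ← Complex.normSq_eq_conj_mul_self,
      Complex.normSq_eq_norm_sq, norm_centralChar]
    norm_num

/-! ### Restriction, central quotients and the upper central series -/

/-- The `h`-class that contains a given `g`-class, for `h ⊆ g`. -/
def classMap {g h : M.Lat} (hle : h ≤ g) : M.Class g → M.Class h :=
  Quotient.map' id fun _ _ H α hα => H α (hle hα)

/-- The restriction homomorphism: it sends a central `g`-class to the `h`-class containing it. -/
def res {g h : M.Lat} (hle : h ≤ g) : M.Center g →* M.Center h :=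
  MonoidHom.mk' (fun z => ⟨classMap hle z.1, by
      obtain ⟨⟨p⟩, hp⟩ := z
      exact M.isCentral_classOf.mpr fun α hα => M.isCentral_classOf.mp hp α (hle hα)⟩)
    (fun z w => by
      obtain ⟨p, hp⟩ := z.exists_mem
      obtain ⟨q, hq⟩ := w.exists_mem
      obtain ⟨r, hr⟩ := M.exists_fusion_pos p q
      refine Center.eq_of_mem (p := r) (congrArg (classMap hle) (mem_mul hp hq hr)) ?_
      exact mem_mul (congrArg (classMap hle) hp) (congrArg (classMap hle) hq) hr)

/-- The restriction of a central class contains that class. -/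
theorem mem_res {g h : M.Lat} (hle : h ≤ g) {z : M.Center g} {p : P} (hp : p ∈ z.members) :
    p ∈ (res hle z).members :=
  congrArg (classMap hle) hp

theorem centralChar_res {g h : M.Lat} (hle : h ≤ g) (z : M.Center g) (α : h.1) :
    M.centralChar (res hle z) α = M.centralChar z ⟨α, hle α.2⟩ := by
  obtain ⟨p, hp⟩ := z.exists_mem
  have h1 := (irr_eq_centralChar (mem_res hle hp) α).symm.trans
    (irr_eq_centralChar hp ⟨α, hle α.2⟩)
  refine mul_right_cancel₀ ?_ h1
  exact_mod_cast (M.qdim_pos α).ne'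

theorem res_eq_one_iff {g h : M.Lat} (hle : h ≤ g) (z : M.Center g) :
    res hle z = 1 ↔ z.members ⊆ M.dual h := by
  constructor
  · intro hz p hp
    have h1 := mem_res hle hp
    rw [hz] at h1
    exact h1
  · intro hz
    obtain ⟨p, hp⟩ := z.exists_mem
    exact Center.eq_of_mem (mem_res hle hp) (hz hp)

/-- For `h ⊆ g`, the group of those central `g`-classes that are contained in the dual of `h`. -/
def relCenter {g h : M.Lat} (hle : h ≤ g) : Subgroup (M.Center g) where
  carrier := {z | z.members ⊆ M.dual h}
  one_mem' := (res_eq_one_iff hle 1).mp (map_one _)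
  mul_mem' := fun {a b} ha hb => (res_eq_one_iff hle (a * b)).mp (by
    rw [map_mul, (res_eq_one_iff hle a).mpr ha, (res_eq_one_iff hle b).mpr hb, one_mul])
  inv_mem' := fun {a} ha => (res_eq_one_iff hle a⁻¹).mp (by
    rw [map_inv, (res_eq_one_iff hle a).mpr ha, inv_one])

/-- The central quotient of `g` by a subgroup `H` of its center: those elements of `g` on which
the central characters of all classes in `H` are trivial. -/
def centralQuotient (g : M.Lat) (H : Subgroup (M.Center g)) : M.Lat :=
  ⟨{α | ∃ hα : α ∈ g.1, ∀ z ∈ H, M.centralChar z ⟨α, hα⟩ = 1}, by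
    refine ⟨⟨g.2.1, fun z _ => ?_⟩, ?_⟩
    · obtain ⟨p, hp⟩ := z.exists_mem
      have h1 := irr_eq_centralChar hp ⟨M.vac, g.2.1⟩
      have h2 : (M.qdim M.vac : ℂ) = 1 := by rw [← M.irr_vac, M.irr_at_vac]
      rw [h2, M.irr_at_vac, mul_one] at h1
      exact h1.symm
    · rintro α ⟨hα, h1⟩ β ⟨hβ, h2⟩ γ hN
      have hγ := g.2.2 α hα β hβ γ hN
      refine ⟨hγ, fun z hz => ?_⟩
      rw [centralChar_fusion (α := ⟨α, hα⟩) (β := ⟨β, hβ⟩) (γ := ⟨γ, hγ⟩) z hN, h1 z hz,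
        h2 z hz, one_mul]⟩

/-- `h` is a central quotient of `g`. -/
def IsCentralQuotient (h g : M.Lat) : Prop :=
  ∃ H : Subgroup (M.Center g), h = centralQuotient g H

/-- The maximal central quotient of `g`: the central quotient by the whole center. -/
def maxQuotient (g : M.Lat) : M.Lat := centralQuotient g ⊤

/-- Iterated maximal central quotients, with `g` itself as the zeroth term. -/
def higherQuotient (k : ℕ) (g : M.Lat) : M.Lat := maxQuotient^[k] g

theorem IsCentralQuotient.le {h g : M.Lat} (hc : IsCentralQuotient h g) : h ≤ g := by
  obtain ⟨H, rfl⟩ := hc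
  exact fun α hα => hα.1

theorem IsCentralQuotient.maxQuotient_le {h g : M.Lat} (hc : IsCentralQuotient h g) :
    maxQuotient g ≤ h := by
  obtain ⟨H, rfl⟩ := hc
  exact fun α ⟨hα, h1⟩ => ⟨hα, fun z _ => h1 z (Subgroup.mem_top z)⟩

theorem maxQuotient_mono : Monotone (maxQuotient : M.Lat → M.Lat) := by
  rintro h g hle α ⟨hα, h1⟩
  refine ⟨hle hα, fun z _ => ?_⟩
  rw [← centralChar_res hle z ⟨α, hα⟩]
  exact h1 _ (Subgroup.mem_top _)

theorem IsCentralQuotient.higher_le {h g : M.Lat} (hc : IsCentralQuotient h g) (k : ℕ) :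
    higherQuotient k h ≤ higherQuotient k g :=
  maxQuotient_mono.iterate k hc.le

theorem IsCentralQuotient.higher_succ_le {h g : M.Lat} (hc : IsCentralQuotient h g) (k : ℕ) :
    higherQuotient (k + 1) g ≤ higherQuotient k h :=
  maxQuotient_mono.iterate k hc.maxQuotient_le

end ConformalModel

end

namespace ConformalModel

/-! Every joint between centers is an instance of one statement: if `∂g ⊆ h ⊆ g`, then `Z(g) → Z(h)
→ Z(∂g)` is exact in the middle (`mulExact_res_res`). Being a central quotient matters only through
`∂g ⊆ h ⊆ g`. Since `∂` is monotone, this gives the whole descending chain `g ⊇ h ⊇ ∂g ⊇ ∂h ⊇ ...`,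
in which the term two places after `x` is `∂x`, so the statement applies to any three consecutive
terms.

That the composite is trivial is the definition of `∂g`: central characters of `g` equal 1 there.
The substance is the converse: every primary `p` in the dual of `∂g` lies in a central `g`-class.
For `α` in `g`, each constituent `γ` of the fusion of `α` with its conjugate lies in `∂g`, because a
phase times its complex conjugate is 1. Hence `p` takes the value `d_γ` on each such `γ`, and
expanding the product gives `|ρ_p(α)|² = ∑ N d_γ = d_α²`. So `|ρ_p(α)|` has the maximal value `d_α`,
which is the criterion for centrality. A central `h`-class that dies in `Z(∂g)` lies inside the dual
of `∂g`, so the `g`-class of any of its members is a central preimage.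

At the right end `∂^(N+1) h = ∂^(N+1) g`, so the next restriction map, from `Z(∂^N h)`, is trivial,
and exactness becomes surjectivity. -/

theorem centralChar_bar {P : Type*} [Fintype P] [DecidableEq P] {M : ConformalModel P}
    {g : M.Lat} (z : M.Center g) (α : g.1) :
    M.centralChar z ⟨M.bar α, M.bar_mem g α.2⟩ = conj (M.centralChar z α) := by
  obtain ⟨p, hp⟩ := z.exists_mem
  have h1 := irr_eq_centralChar hp ⟨M.bar α, M.bar_mem g α.2⟩
  rw [M.irr_bar_right, irr_eq_centralChar hp α, map_mul, Complex.conj_ofReal, M.qdim_bar] at h1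
  have h2 : (M.qdim α : ℂ) ≠ 0 := by exact_mod_cast (M.qdim_pos α).ne'
  exact (mul_right_cancel₀ h2 h1).symm

/-- The maximal central quotient contains the fusion products of elements of `g` with their
charge conjugates. -/
theorem mem_maxQuotient_of_fusion_bar {P : Type*} [Fintype P] [DecidableEq P]
    {M : ConformalModel P} {g : M.Lat} {α γ : P} (hα : α ∈ g.1)
    (hN : 0 < M.fusion α (M.bar α) γ) : γ ∈ (maxQuotient g).1 := by
  have hb := M.bar_mem g hα
  refine ⟨g.2.2 α hα _ hb γ hN, fun z _ => ?_⟩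
  -- The character is multiplicative along fusion, so its value at `γ` is a phase times its own
  -- conjugate.
  rw [centralChar_fusion (α := ⟨α, hα⟩) (β := ⟨M.bar α, hb⟩) z hN, centralChar_bar z ⟨α, hα⟩,
    Complex.mul_conj, Complex.normSq_eq_norm_sq, norm_centralChar]
  norm_num

/-- The `g`-class of any member of the dual of the maximal central quotient of `g` is central. -/
theorem isCentral_of_mem_dual_maxQuotient {P : Type*} [Fintype P] [DecidableEq P]
    {M : ConformalModel P} {g : M.Lat} {p : P} (hp : p ∈ M.dual (maxQuotient g)) :
    M.IsCentral (M.classOf g p) := by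
  refine M.isCentral_classOf.mpr fun α hα => ?_
  -- On `∂g` the primary `p` cannot be told apart from the vacuum, whose values are the quantum
  -- dimensions.
  have hirr : ∀ γ, 0 < M.fusion α (M.bar α) γ → M.irr p γ = M.qdim γ := fun γ hγ => by
    rw [← M.irr_vac]
    exact M.classOf_eq_iff.mp hp γ (mem_maxQuotient_of_fusion_bar hα hγ)
  -- Both sides expand over the same fusion product: the left as `irr p α * irr p (bar α)`, the
  -- right as `qdim α * qdim (bar α)`. The comparison runs in `ℂ`, where `irr_mul` lives.
  have hsq : ((‖M.irr p α‖ ^ 2 : ℝ) : ℂ) = ((M.qdim α ^ 2 : ℝ) : ℂ) := by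
    have hd : M.qdim α ^ 2 = M.qdim α * M.qdim (M.bar α) := by rw [M.qdim_bar, sq]
    rw [← Complex.normSq_eq_norm_sq, ← Complex.mul_conj, ← M.irr_bar_right, M.irr_mul, hd,
      M.qdim_mul]
    push_cast
    refine Finset.sum_congr rfl fun γ _ => ?_
    -- Only primaries that do occur are known to lie in `∂g`; the others have coefficient zero.
    rcases Nat.eq_zero_or_pos (M.fusion α (M.bar α) γ) with h0 | hpos
    · simp [h0]
    · rw [hirr γ hpos]
  exact (pow_left_inj₀ (norm_nonneg _) (M.qdim_pos α).le two_ne_zero).mp (by exact_mod_cast hsq)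

/-- For `h` between `g` and its maximal central quotient `k`, a central `h`-class restricts
trivially to `k` exactly when it is the restriction of a central `g`-class. -/
theorem mulExact_res_res {P : Type*} [Fintype P] [DecidableEq P] {M : ConformalModel P}
    {g h k : M.Lat} (hhg : h ≤ g) (hkh : k ≤ h) (hk : k = maxQuotient g) :
    Function.MulExact (res hhg) (res hkh) := by
  -- Stating `k = maxQuotient g` as an equation lets the result be used at `higherQuotient (k + 1)
  -- g` without transporting elements between centers.
  subst hk
  intro z
  rw [res_eq_one_iff]
  constructor
  · intro hz
    obtain ⟨p, hp⟩ := z.exists_mem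
    -- Any member of `z` yields a preimage, namely its own `g`-class; the restriction of that class
    -- and `z` are `h`-classes sharing `p`.
    refine ⟨⟨M.classOf g p, isCentral_of_mem_dual_maxQuotient (hz hp)⟩, ?_⟩
    exact Center.eq_of_mem (mem_res hhg rfl) hp
  · rintro ⟨w, rfl⟩
    rw [← res_eq_one_iff hkh]
    refine centralChar_injective fun α => ?_
    obtain ⟨hα, h1⟩ := α.2
    rw [centralChar_res, centralChar_res, centralChar_one]
    exact h1 w (Subgroup.mem_top w)

/-- Iteration unfolds with the extra step applied first, to `g`; the exactness argument needs it
applied last. -/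
theorem higherQuotient_succ {P : Type*} [Fintype P] [DecidableEq P] {M : ConformalModel P}
    (k : ℕ) (g : M.Lat) : higherQuotient (k + 1) g = maxQuotient (higherQuotient k g) :=
  Function.iterate_succ_apply' maxQuotient k g

end ConformalModel

open ConformalModel in
-- For `k < N` the two exactness claims concern the joints `Z(∂^k h)` and `Z(∂^(k+1) g)`. Together
-- with `Z(g)` on the left and surjectivity onto `Z(∂^N h)` on the right, they cover every joint;
-- for `N = 0` only the two ends remain.
theorem mainTheorem1 {P : Type*} [Fintype P] [DecidableEq P] (M : ConformalModel P)
    (g h : M.Lat) (hgh : IsCentralQuotient h g) (N : ℕ)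
    (hN : IsGreatest {k : ℕ | higherQuotient k h ≠ higherQuotient k g} N) :
    Function.Injective (relCenter hgh.le).subtype ∧
    Function.MulExact (relCenter hgh.le).subtype (res hgh.le) ∧
    (∀ k < N,
      Function.MulExact (res (hgh.higher_le k)) (res (hgh.higher_succ_le k)) ∧
      Function.MulExact (res (hgh.higher_succ_le k)) (res (hgh.higher_le (k + 1)))) ∧
    Function.Surjective (res (hgh.higher_le N)) := by
  refine ⟨Subtype.val_injective, fun z => ?_, fun k _ =>
    ⟨mulExact_res_res _ _ (higherQuotient_succ k g),
      mulExact_res_res _ _ (higherQuotient_succ k h)⟩, fun z => ?_⟩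
  · rw [res_eq_one_iff]
    exact ⟨fun hz => ⟨⟨z, hz⟩, rfl⟩, by rintro ⟨w, rfl⟩; exact w.2⟩
  · have heq : higherQuotient (N + 1) h = higherQuotient (N + 1) g := by
      by_contra hne
      exact absurd (hN.2 hne) (Nat.not_succ_le_self N)
    -- Exactness one place beyond the end of the sequence: it suffices that `z` restricts trivially
    -- to `∂^(N+1) g`.
    refine (mulExact_res_res _ (hgh.higher_succ_le N) (higherQuotient_succ N g) z).mp ?_
    refine centralChar_injective fun α => ?_
    -- As `∂^(N+1) g = ∂(∂^N h)`, all central characters of `∂^N h` equal 1 at `α`.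
    have hα : α.1 ∈ (maxQuotient (higherQuotient N h)).1 := by
      rw [← higherQuotient_succ, heq]
      exact α.2
    obtain ⟨_, h1⟩ := hα
    rw [centralChar_res, centralChar_one]
    exact h1 z (Subgroup.mem_top z)
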